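/- Let $\Lambda$ be a selfinjective artin algebra (that is, $\Lambda$ is a finitely generated algebra, as a module, over a commutative artinian ring, and it is injective as a right module over itself), and let $\mathrm{proj}\,\Lambda$ be the category of finitely generated projective right $\Lambda$-modules. For $n\in\mathbb{N}$ let $\mathbf{C_n}(\mathrm{proj}\,\Lambda)$ be the category of cochain complexes $X$ over $\mathrm{proj}\,\Lambda$ with $X^i=0$ for $i\notin\{1,\dots,n\}$, with chain maps as morphisms. Assume that $\mathbf{C_n}(\mathrm{proj}\,\Lambda)$ is of finite type, i.e. has only finitely many indecomposable objects up to isomorphism. A section is a split monomorphism and a retraction is a split epimorphism. A morphism $f$ of a category is irreducible if it is neither a section nor a retraction and, whenever $f=gh$, either $h$ is a section or $g$ is a retraction. Let $\Re$ be the radical of $\mathbf{C_n}(\mathrm{proj}\,\Lambda)$, the two-sided ideal generated by the non-isomorphisms between indecomposable objects, and let $\Re^m$ be its powers. The left degree $d_l(f)$ of an irreducible morphism $f:X\to Y$ with $X$ or $Y$ indecomposable is the least integer $m\ge 1$ for which there are an object $M$ and a morphism $\varphi\in\Re^m(M,X)\setminus\Re^{m+1}(M,X)$ with $f\varphi\in\Re^{m+2}(M,Y)$;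 it is $\infty$ if there is no such $m$. Dually, the right degree $d_r(f)$ is the least integer $m\ge 1$ for which there are an object $M$ and a morphism $\varphi\in\Re^m(Y,M)\setminus\Re^{m+1}(Y,M)$ with $\varphi f\in\Re^{m+2}(X,M)$; it is $\infty$ if there is no such $m$. Let $f=\{f^i\}_{i=1}^n:X\to Y$ be an irreducible morphism in $\mathbf{C_n}(\mathrm{proj}\,\Lambda)$ with $X$ or $Y$ indecomposable. Then: (a) If $f$ is of type (sec), i.e. every $f^i$ with $1\le i\le n$ is a section in $\mathrm{proj}\,\Lambda$, then $d_r(f)<\infty$. (b) If $f$ is of type (ret), i.e. every $f^i$ with $1\le i\le n$ is a retraction in $\mathrm{proj}\,\Lambda$, then $d_l(f)<\infty$. (c) If $f$ is of type (ret-irred-sec), i.e. there is $i\in\{1,\dots,n\}$ such that $f^i$ is irreducible in $\mathrm{proj}\,\Lambda$, $f^j$ is a section for all $i<j\le n$ and $f^j$ is a retraction for all $1\le j<i$, then $d_l(f)<\infty$ and $d_r(f)<\infty$. -/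

import Mathlib

open CategoryTheory CategoryTheory.Limits

universe u v w

namespace CnProj

section Category

variable {C : Type u} [Category.{v} C]

/-- A morphism is irreducible if it is neither a section (split mono) nor a retraction (split epi),
and in any factorization `f = h ≫ g` (first `h`, then `g`), `h` is a section or `g` is a
retraction. -/
def IsIrreducibleHom {X Y : C} (f : X ⟶ Y) : Prop :=
  ¬ IsSplitMono f ∧ ¬ IsSplitEpi f ∧
    ∀ (Z : C) (h : X ⟶ Z) (g : Z ⟶ Y), h ≫ g = f → IsSplitMono h ∨ IsSplitEpi g

variable [Preadditive C] [HasBinaryBiproducts C]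

variable (C) in
/-- Finite type: there are only finitely many indecomposable objects up to isomorphism. -/
def IsOfFiniteType : Prop :=
  ∃ (k : ℕ) (M : Fin k → C), ∀ X : C, Indecomposable X → ∃ i, Nonempty (X ≅ M i)

/-- The radical: the two-sided ideal of the category generated by the non-isomorphisms between
indecomposable objects. -/
def rad (X Y : C) : AddSubgroup (X ⟶ Y) :=
  AddSubgroup.closure {f | ∃ (A B : C) (a : X ⟶ A) (g : A ⟶ B) (b : B ⟶ Y),
    Indecomposable A ∧ Indecomposable B ∧ ¬ IsIso g ∧ f = a ≫ g ≫ b}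

/-- Powers of the radical: the zeroth power consists of all morphisms, and the power `m + 1`
consists of the finite sums of composites of a morphism in the `m`-th power and a radical one. -/
def radPow : ℕ → ∀ X Y : C, AddSubgroup (X ⟶ Y)
  | 0, _, _ => ⊤
  | m + 1, X, Y => AddSubgroup.closure {f | ∃ (Z : C) (g : X ⟶ Z) (h : Z ⟶ Y),
      g ∈ radPow m X Z ∧ h ∈ rad Z Y ∧ f = g ≫ h}

/-- The left degree of `f : X ⟶ Y`: the least `m ≥ 1` for which some `φ : M ⟶ X` lies in the
`m`-th but not in the `(m+1)`-st power of the radical while the composite of `φ` and `f` lies in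
the `(m+2)`-nd power; it is `⊤` if there is no such `m`. -/
noncomputable def leftDegree {X Y : C} (f : X ⟶ Y) : ℕ∞ :=
  ⨅ (m : ℕ) (_ : 1 ≤ m ∧ ∃ (M : C) (φ : M ⟶ X),
    φ ∈ radPow m M X ∧ φ ∉ radPow (m + 1) M X ∧ φ ≫ f ∈ radPow (m + 2) M Y), (m : ℕ∞)

/-- The right degree of `f : X ⟶ Y`: the least `m ≥ 1` for which some `φ : Y ⟶ M` lies in the
`m`-th but not in the `(m+1)`-st power of the radical while the composite of `f` and `φ` lies in
the `(m+2)`-nd power; it is `⊤` if there is no such `m`. -/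
noncomputable def rightDegree {X Y : C} (f : X ⟶ Y) : ℕ∞ :=
  ⨅ (m : ℕ) (_ : 1 ≤ m ∧ ∃ (M : C) (φ : Y ⟶ M),
    φ ∈ radPow m Y M ∧ φ ∉ radPow (m + 1) Y M ∧ f ≫ φ ∈ radPow (m + 2) X M), (m : ℕ∞)

end Category

/-- Closure under isomorphisms and binary biproducts gives closure under binary products. -/
theorem isClosedUnderBinaryProducts_of_biprod {C : Type u} [Category.{v} C] [Preadditive C]
    [HasBinaryBiproducts C] {P : ObjectProperty C} [P.IsClosedUnderIsomorphisms]
    (h : ∀ X Y : C, P X → P Y → P (X ⊞ Y)) : P.IsClosedUnderBinaryProducts := by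
  refine ⟨fun X hX => ?_⟩
  obtain ⟨p⟩ := hX
  exact P.prop_of_iso
    (IsLimit.conePointsIsoOfNatIso p.isLimit
      (BinaryBiproduct.isLimit (p.diag.obj ⟨WalkingPair.left⟩) (p.diag.obj ⟨WalkingPair.right⟩))
      (diagramIsoPair p.diag)).symm
    (h _ _ (p.prop_diag_obj _) (p.prop_diag_obj _))

section Modules

variable (Λ : Type u) [Ring Λ]

/-- Finitely generated projective right `Λ`-modules. -/
def isProj : ObjectProperty (ModuleCat.{u} Λᵐᵒᵖ) :=
  fun M => Module.Finite Λᵐᵒᵖ M ∧ Module.Projective Λᵐᵒᵖ M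

/-- The category `proj Λ` of finitely generated projective right `Λ`-modules. -/
abbrev ProjCat : Type (u + 1) := (isProj Λ).FullSubcategory

instance : (isProj Λ).IsClosedUnderIsomorphisms where
  of_iso {M N} e h := by
    have := h.1
    have := h.2
    exact ⟨Module.Finite.equiv e.toLinearEquiv, Module.Projective.of_equiv e.toLinearEquiv⟩

instance : (isProj Λ).IsClosedUnderBinaryProducts :=
  isClosedUnderBinaryProducts_of_biprod fun M N hM hN => by
    have := hM.1
    have := hM.2
    have := hN.1
    have := hN.2
    refine (isProj Λ).prop_of_iso (ModuleCat.biprodIsoProd M N).symm ⟨?_, ?_⟩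
    · exact inferInstanceAs (Module.Finite Λᵐᵒᵖ (M × N))
    · exact inferInstanceAs (Module.Projective Λᵐᵒᵖ (M × N))

instance : HasBinaryBiproducts (ProjCat Λ) :=
  have : HasBinaryProducts (ProjCat Λ) := hasLimitsOfShape_of_closedUnderLimits _ _
  HasBinaryBiproducts.of_hasBinaryProducts

/-- Complexes over `proj Λ` that vanish outside the degrees `1, …, n`. -/
def isSupported (n : ℕ) : ObjectProperty (CochainComplex (ProjCat Λ) ℤ) :=
  fun K => ∀ i : ℤ, i ∉ Set.Icc 1 (n : ℤ) → IsZero (K.X i)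

/-- The category `C_n(proj Λ)`, a full subcategory of the category of cochain complexes. -/
abbrev Cn (n : ℕ) : Type (u + 1) := (isSupported Λ n).FullSubcategory

instance (n : ℕ) : (isSupported Λ n).IsClosedUnderIsomorphisms where
  of_iso e h i hi := (h i hi).of_iso
    ((HomologicalComplex.eval _ _ i).mapIso e.symm)

instance : HasBinaryBiproducts (CochainComplex (ProjCat Λ) ℤ) :=
  ⟨fun K L => inferInstanceAs (HasBinaryBiproduct K L)⟩

instance (n : ℕ) : (isSupported Λ n).IsClosedUnderBinaryProducts :=
  isClosedUnderBinaryProducts_of_biprod fun K L hK hL i hi => by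
    refine IsZero.of_iso ?_ (HomologicalComplex.biprodXIso K L i)
    exact (biprod_isZero_iff _ _).2 ⟨hK i hi, hL i hi⟩

instance (n : ℕ) : HasBinaryBiproducts (Cn Λ n) :=
  have : HasBinaryProducts (Cn Λ n) := hasLimitsOfShape_of_closedUnderLimits _ _
  HasBinaryBiproducts.of_hasBinaryProducts

variable {Λ} {n : ℕ} {X Y : Cn Λ n}

/-- Type `(sec)`: the components in degrees `1, …, n` are sections in `proj Λ`. -/
def IsTypeSec (f : X ⟶ Y) : Prop :=
  ∀ i ∈ Set.Icc (1 : ℤ) n, IsSplitMono (f.hom.f i)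

/-- Type `(ret)`: the components in degrees `1, …, n` are retractions in `proj Λ`. -/
def IsTypeRet (f : X ⟶ Y) : Prop :=
  ∀ i ∈ Set.Icc (1 : ℤ) n, IsSplitEpi (f.hom.f i)

/-- Type `(ret-irred-sec)`: some component `f^i` is irreducible in `proj Λ`, the components `f^j`
with `j > i` are sections and those with `j < i` are retractions. -/
def IsTypeRetIrredSec (f : X ⟶ Y) : Prop :=
  ∃ i ∈ Set.Icc (1 : ℤ) n, IsIrreducibleHom (f.hom.f i) ∧
    ∀ j ∈ Set.Icc (1 : ℤ) n,
      (i < j → IsSplitMono (f.hom.f j)) ∧ (j < i → IsSplitEpi (f.hom.f j))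

end Modules

end CnProj

/-!
If a power of the radical vanishes, then every nonzero radical morphism `φ : M ⟶ X` lies in
`radPow m` but not in `radPow (m + 1)` for some `m ≥ 1`. Hence the left degree of `f : X ⟶ Y` is
finite as soon as `φ ≫ f = 0` for such a `φ`, and dually for the right degree. When `f` is
irreducible, every `φ` with `φ ≫ f = 0` is radical (`mem_rad_of_comp_eq_zero`): otherwise `f` would
vanish on a nonzero direct summand of `X`. So it suffices to show that `f` is not a monomorphism
for the left degree, and not an epimorphism for the right degree.

The radical is nilpotent (`exists_radPow_eq_zero`). Endomorphism rings in `C_n(proj Λ)` are finite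
over `k`, hence artinian. Finite type gives an object `W` having all indecomposable objects as
retracts. By Fitting's lemma, non-isomorphisms between indecomposable objects induce elements of
the Jacobson radical of `End W`, which is nilpotent, and every object is a sum of indecomposable
ones (`isSumOfIndecomposables`).

The morphism `f` is not a monomorphism if some component `f^i` is not a monomorphism of `proj Λ`: a
map `P ⟶ X^i` annihilated by `f^i` extends to a map from the contractible complex `P = P` in the
degrees `i` and `i + 1` (from `P` alone if `i = n`). The dual statement uses the degrees `i - 1` and
`i`. If all components are retractions, some component is not a monomorphism, as otherwise `f`
would be an isomorphism; the case of sections is dual. An irreducible component is neither a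
monomorphism nor an epimorphism of `proj Λ`, because over a selfinjective algebra these split. For
monomorphisms this is the injectivity of projective modules (`isSplitMono_of_mono`). For
epimorphisms (`isSplitEpi_of_epi`) it is the fact that every simple module embeds in a projective
module (`exists_embedding_of_isSimpleModule`), which follows from the bijectivity of the Nakayama
permutation, a count on the finite set of indecomposable projective modules.
-/

namespace CnProj

/-! ### Fitting's lemma in artinian rings -/

/-- Fitting's lemma. The kernel and the range of a high power of right multiplication by `x` are
complementary left ideals, hence generated by complementary idempotents. -/
theorem isNilpotent_or_isUnit_of_isArtinianRing {R : Type*} [Ring R] [IsArtinianRing R]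
    (hR : ∀ e : R, e * e = e → e = 0 ∨ e = 1) (x : R) : IsNilpotent x ∨ IsUnit x := by
  let ρ : Module.End R R := LinearMap.toSpanSingleton R R x
  have hρ : ∀ (n : ℕ) (r : R), (ρ ^ n) r = r * x ^ n := by
    intro n
    induction n with
    | zero => simp
    | succ n ih => intro r; rw [pow_succ', Module.End.mul_apply, ih, pow_succ, ← mul_assoc]; rfl
  obtain ⟨n, hn, hn1⟩ := ((LinearMap.eventually_isCompl_ker_pow_range_pow ρ).and
    (Filter.eventually_ge_atTop 1)).exists
  obtain ⟨a, ha, b, hb, hab⟩ := Submodule.mem_sup.1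
    (show (1 : R) ∈ LinearMap.ker (ρ ^ n) ⊔ LinearMap.range (ρ ^ n) by
      rw [hn.sup_eq_top]; trivial)
  have hmul : a * b = 0 := by
    have h : a * b = a - a * a := by rw [eq_sub_iff_add_eq, ← mul_add, add_comm b, hab, mul_one]
    have h1 : a * b ∈ LinearMap.ker (ρ ^ n) := by
      rw [h]
      exact sub_mem ha (Ideal.mul_mem_left _ a ha)
    have h2 : a * b ∈ LinearMap.range (ρ ^ n) := Ideal.mul_mem_left _ a hb
    exact (Submodule.mem_bot R).1 (hn.inf_eq_bot ▸ ⟨h1, h2⟩)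
  have haa : a * a = a := by
    have : a * (a + b) = a := by rw [hab, mul_one]
    rwa [mul_add, hmul, add_zero] at this
  rcases hR a haa with rfl | rfl
  · right
    rw [zero_add] at hab
    subst hab
    obtain ⟨y, hy⟩ := hb
    rw [hρ] at hy
    obtain ⟨m, rfl⟩ : ∃ m, n = m + 1 := ⟨n - 1, by omega⟩
    rw [pow_succ, ← mul_assoc] at hy
    exact .of_mul_eq_one_right _ hy
  · left
    rw [LinearMap.mem_ker, hρ, one_mul] at ha
    exact ⟨n, ha⟩

/-! ### Indecomposable objects -/

section Category

variable {C : Type u} [Category.{v} C] [Preadditive C]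

/-- Splittings of two complementary idempotents decompose the object as a biproduct. -/
noncomputable def isoBiprodOfTotal {X Y Z : C} [HasBinaryBiproduct Y Z] (i : Y ⟶ X) (p : X ⟶ Y)
    (j : Z ⟶ X) (q : X ⟶ Z) (hip : i ≫ p = 𝟙 Y) (hjq : j ≫ q = 𝟙 Z)
    (total : p ≫ i + q ≫ j = 𝟙 X) : X ≅ Y ⊞ Z :=
  let b : BinaryBicone Y Z :=
    { pt := X, fst := p, snd := q, inl := i, inr := j, inl_fst := hip, inr_snd := hjq
      inl_snd := by
        have h : i ≫ (p ≫ i + q ≫ j) ≫ q = i ≫ q := by rw [total, Category.id_comp]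
        simpa [reassoc_of% hip, hjq] using h
      inr_fst := by
        have h : j ≫ (p ≫ i + q ≫ j) ≫ p = j ≫ p := by rw [total, Category.id_comp]
        simpa [reassoc_of% hjq, hip] using h }
  biprod.uniqueUpToIso Y Z (b := b) (isBinaryBilimitOfTotal b total)

/-- Splitting the zero idempotent of any object gives a zero object. -/
theorem hasZeroObject_of_isIdempotentComplete [IsIdempotentComplete C] [Nonempty C] :
    HasZeroObject C := by
  obtain ⟨X⟩ := ‹Nonempty C›
  obtain ⟨Y, i, p, hip, hpi⟩ := IsIdempotentComplete.idempotents_split X 0 zero_comp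
  refine ⟨Y, (IsZero.iff_id_eq_zero Y).2 ?_⟩
  rw [← Category.comp_id (𝟙 Y), ← hip, Category.assoc, reassoc_of% hpi]
  simp

variable [HasBinaryBiproducts C]

section IdempotentComplete

variable [IsIdempotentComplete C]

theorem eq_zero_or_eq_id_of_indecomposable {X : C} (hX : Indecomposable X) (e : X ⟶ X)
    (he : e ≫ e = e) : e = 0 ∨ e = 𝟙 X := by
  obtain ⟨Y, i, p, hip, hpi⟩ := IsIdempotentComplete.idempotents_split X e he
  obtain ⟨Z, j, q, hjq, hqj⟩ := IsIdempotentComplete.idempotents_split X (𝟙 X - e) (by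
    simp [he])
  rcases hX.2 Y Z (isoBiprodOfTotal i p j q hip hjq (by rw [hpi, hqj]; abel)) with h | h
  · left
    rw [← hpi, h.eq_of_src i 0, comp_zero]
  · right
    rw [h.eq_of_src j 0, comp_zero] at hqj
    exact (sub_eq_zero.1 hqj.symm).symm

/-- A section into an indecomposable object with nonzero source is an isomorphism. -/
theorem isIso_of_comp_eq_id {A B : C} (hA : ¬ IsZero A) (hB : Indecomposable B) (g : A ⟶ B)
    (r : B ⟶ A) (h : g ≫ r = 𝟙 A) : IsIso g := by
  rcases eq_zero_or_eq_id_of_indecomposable hB (r ≫ g) (by simp [reassoc_of% h]) with h0 | h1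
  · refine absurd ((IsZero.iff_id_eq_zero A).2 ?_) hA
    rw [← Category.comp_id (𝟙 A), ← h, Category.assoc, reassoc_of% h0]
    simp
  · exact ⟨r, h, h1⟩

variable [∀ X : C, IsArtinianRing (End X)]

theorem isNilpotent_or_isUnit_of_indecomposable {X : C} (hX : Indecomposable X) (x : End X) :
    IsNilpotent x ∨ IsUnit x :=
  isNilpotent_or_isUnit_of_isArtinianRing
    (R := End X) (fun e he => eq_zero_or_eq_id_of_indecomposable hX (End.asHom e) he) x

end IdempotentComplete

/-! ### Decompositions into indecomposable objects -/

/-- The identity of `X` is a finite sum of endomorphisms which factor through indecomposable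
objects. -/
def IsSumOfIndecomposables (X : C) : Prop :=
  ∃ (ι : Type) (_ : Fintype ι) (A : ι → C) (i : ∀ a, A a ⟶ X) (p : ∀ a, X ⟶ A a),
    (∀ a, Indecomposable (A a)) ∧ ∑ a, p a ≫ i a = 𝟙 X

theorem IsSumOfIndecomposables.of_iso_biprod {X Y Z : C} (e : X ≅ Y ⊞ Z)
    (hY : IsSumOfIndecomposables Y) (hZ : IsSumOfIndecomposables Z) :
    IsSumOfIndecomposables X := by
  obtain ⟨ι, _, A, i, p, hA, h⟩ := hY
  obtain ⟨κ, _, B, j, q, hB, h'⟩ := hZ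
  refine ⟨ι ⊕ κ, inferInstance, Sum.elim A B,
    Sum.rec (fun a => i a ≫ biprod.inl ≫ e.inv) (fun b => j b ≫ biprod.inr ≫ e.inv),
    Sum.rec (fun a => e.hom ≫ biprod.fst ≫ p a) (fun b => e.hom ≫ biprod.snd ≫ q b),
    by rintro (a | b); exacts [hA a, hB b], ?_⟩
  have h1 : ∑ a, (e.hom ≫ biprod.fst ≫ p a) ≫ i a ≫ biprod.inl ≫ e.inv =
      e.hom ≫ (biprod.fst ≫ biprod.inl) ≫ e.inv := by
    have (a : ι) : (e.hom ≫ biprod.fst ≫ p a) ≫ i a ≫ biprod.inl ≫ e.inv =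
        e.hom ≫ biprod.fst ≫ (p a ≫ i a) ≫ biprod.inl ≫ e.inv := by simp
    simp_rw [this, ← Preadditive.comp_sum, ← Preadditive.sum_comp, h, Category.id_comp,
      Category.assoc]
  have h2 : ∑ b, (e.hom ≫ biprod.snd ≫ q b) ≫ j b ≫ biprod.inr ≫ e.inv =
      e.hom ≫ (biprod.snd ≫ biprod.inr) ≫ e.inv := by
    have (b : κ) : (e.hom ≫ biprod.snd ≫ q b) ≫ j b ≫ biprod.inr ≫ e.inv =
        e.hom ≫ biprod.snd ≫ (q b ≫ j b) ≫ biprod.inr ≫ e.inv := by simp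
    simp_rw [this, ← Preadditive.comp_sum, ← Preadditive.sum_comp, h', Category.id_comp,
      Category.assoc]
  refine (Fintype.sum_sum_type _).trans ((congr_arg₂ (· + ·) h1 h2).trans ?_)
  rw [← Preadditive.comp_add, ← Preadditive.add_comp, biprod.total, Category.id_comp,
    e.hom_inv_id]

/-- Every object decomposes, because splitting off a nonzero summand of a retract `Y` of `X`
strictly shrinks the left ideal of `End X` generated by the idempotent of `Y`. -/
theorem isSumOfIndecomposables [∀ X : C, IsArtinianRing (End X)] (X : C) :
    IsSumOfIndecomposables X := by
  suffices H : ∀ (I : Ideal (End X)) (Y : C) (i : Y ⟶ X) (p : X ⟶ Y), i ≫ p = 𝟙 Y →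
      Ideal.span {End.of (p ≫ i)} = I → IsSumOfIndecomposables Y from
    H _ X (𝟙 X) (𝟙 X) (by simp) rfl
  intro I
  induction I using WellFoundedLT.induction with
  | ind I ih =>
  intro Y i p hip hI
  by_cases h0 : IsZero Y
  · exact ⟨Empty, inferInstance, Empty.elim, fun a => a.elim, fun a => a.elim, fun a => a.elim,
      h0.eq_of_src _ _⟩
  by_cases hY : Indecomposable Y
  · exact ⟨Unit, inferInstance, fun _ => Y, fun _ => 𝟙 Y, fun _ => 𝟙 Y, fun _ => hY, by simp⟩
  -- A summand `Y'` of `Y` whose complement is nonzero generates a smaller left ideal.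
  have key : ∀ (Y' Z' : C) (a : Y' ⟶ Y) (b : Y ⟶ Y') (c : Z' ⟶ Y), a ≫ b = 𝟙 Y' → c ≫ b = 0 →
      Mono c → ¬ IsZero Z' → IsSumOfIndecomposables Y' := by
    intro Y' Z' a b c hab hcb hc hZ'
    have hle : Ideal.span {End.of ((p ≫ b) ≫ a ≫ i)} ≤ I := by
      rw [← hI, Ideal.span_singleton_le_iff_mem, Ideal.mem_span_singleton']
      refine ⟨End.of (p ≫ b ≫ a ≫ i), ?_⟩
      change (p ≫ i) ≫ p ≫ b ≫ a ≫ i = (p ≫ b) ≫ a ≫ i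
      simp [reassoc_of% hip]
    refine ih _ (lt_of_le_of_ne hle fun heq => hZ' ?_) Y' (a ≫ i) (p ≫ b)
      (by simp [reassoc_of% hip, hab]) rfl
    rw [← hI] at heq
    obtain ⟨r, hr⟩ := Ideal.mem_span_singleton'.1
      (heq ▸ Ideal.mem_span_singleton_self (End.of (p ≫ i)) :
        End.of (p ≫ i) ∈ Ideal.span {End.of ((p ≫ b) ≫ a ≫ i)})
    replace hr : ((p ≫ b) ≫ a ≫ i) ≫ r.asHom = p ≫ i := hr
    have h1 : c ≫ i ≫ (p ≫ i) ≫ p = 0 := by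
      rw [← hr]
      simp only [Category.assoc, reassoc_of% hip, reassoc_of% hcb, zero_comp]
    simp only [Category.assoc, hip, Category.comp_id] at h1
    rw [IsZero.iff_id_eq_zero, ← cancel_mono c, zero_comp, h1, comp_zero]
  obtain ⟨Y₁, Y₂, ⟨e⟩, h₁, h₂⟩ : ∃ Y₁ Y₂ : C, Nonempty (Y ≅ Y₁ ⊞ Y₂) ∧ ¬ IsZero Y₁ ∧ ¬ IsZero Y₂ := by
    by_contra hcon
    push Not at hcon
    exact hY ⟨h0, fun Y₁ Y₂ e => or_iff_not_imp_left.2 (hcon Y₁ Y₂ ⟨e⟩)⟩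
  refine .of_iso_biprod e
    (key Y₁ Y₂ (biprod.inl ≫ e.inv) (e.hom ≫ biprod.fst) (biprod.inr ≫ e.inv)
      (by simp) (by simp) inferInstance h₂)
    (key Y₂ Y₁ (biprod.inr ≫ e.inv) (e.hom ≫ biprod.snd) (biprod.inl ≫ e.inv)
      (by simp) (by simp) inferInstance h₁)

/-! ### Nilpotency of the radical -/

/-- When every indecomposable object is isomorphic to a member of a finite family, the biproduct of
the family has every indecomposable object as a retract. -/
theorem exists_forall_retract_of_isOfFiniteType [IsIdempotentComplete C]
    (hC : IsOfFiniteType C) [Nonempty C] :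
    ∃ W : C, ∀ A : C, Indecomposable A → ∃ (ι : A ⟶ W) (π : W ⟶ A), ι ≫ π = 𝟙 A := by
  obtain ⟨k, M, hM⟩ := hC
  have : HasZeroObject C := hasZeroObject_of_isIdempotentComplete
  have : HasFiniteProducts C := hasFiniteProducts_of_has_binary_and_terminal
  have : HasFiniteBiproducts C := .of_hasFiniteProducts
  refine ⟨⨁ M, fun A hA => ?_⟩
  obtain ⟨i, ⟨e⟩⟩ := hM A hA
  exact ⟨e.hom ≫ biproduct.ι M i, biproduct.π M i ≫ e.inv, by simp⟩

theorem mem_radPow_one {X Y : C} {φ : X ⟶ Y} (hφ : φ ∈ rad X Y) : φ ∈ radPow 1 X Y :=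
  AddSubgroup.subset_closure ⟨X, 𝟙 X, φ, trivial, hφ, by simp⟩

variable [∀ X : C, IsArtinianRing (End X)]

/-- A morphism outside the radical has a component between indecomposable objects that is an
isomorphism. -/
theorem exists_isIso_of_notMem_rad {X Y : C} (φ : X ⟶ Y) (hφ : φ ∉ rad X Y) :
    ∃ (A B : C) (i : A ⟶ X) (q : Y ⟶ B), Indecomposable A ∧ Indecomposable B ∧
      IsIso (i ≫ φ ≫ q) := by
  by_contra hcon
  refine hφ ?_
  obtain ⟨s, _, A, i, p, hA, hX⟩ := isSumOfIndecomposables X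
  obtain ⟨t, _, B, j, q, hB, hY⟩ := isSumOfIndecomposables Y
  rw [← Category.comp_id φ, ← Category.id_comp φ, ← hX, ← hY, Preadditive.sum_comp,
    Preadditive.sum_comp]
  refine sum_mem fun a _ => ?_
  rw [Preadditive.comp_sum]
  refine sum_mem fun b _ => AddSubgroup.subset_closure
    ⟨A a, B b, p a, i a ≫ φ ≫ q b, j b, hA a, hB b, fun h => hcon ⟨_, _, i a, q b, hA a, hB b, h⟩,
      by simp⟩

/-- A left annihilator of an irreducible morphism is radical: otherwise the morphism would vanish
on a nonzero direct summand of its source, and factoring it through the complementary idempotent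
contradicts irreducibility. -/
theorem mem_rad_of_comp_eq_zero {M X Y : C} {f : X ⟶ Y} (hf : IsIrreducibleHom f) (φ : M ⟶ X)
    (hφf : φ ≫ f = 0) : φ ∈ rad M X := by
  by_contra hφ
  obtain ⟨A, B, i, q, hA, hB, hiso⟩ := exists_isIso_of_notMem_rad φ hφ
  let s : B ⟶ X := inv (i ≫ φ ≫ q) ≫ i ≫ φ
  have hsq : s ≫ q = 𝟙 B := by simp [s, - IsIso.inv_comp]
  have hsf : s ≫ f = 0 := by simp [s, hφf]
  rcases hf.2.2 X (𝟙 X - q ≫ s) f (by simp [hsf]) with h | h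
  · have h1 : s ≫ (𝟙 X - q ≫ s) = 0 := by simp [reassoc_of% hsq]
    have h2 : s = 0 := zero_of_comp_mono _ h1
    exact hB.1 ((IsZero.iff_id_eq_zero B).2 (by rw [← hsq, h2, zero_comp]))
  · exact hf.2.1 h

theorem mem_rad_of_eq_zero_comp {M X Y : C} {f : X ⟶ Y} (hf : IsIrreducibleHom f) (φ : Y ⟶ M)
    (hfφ : f ≫ φ = 0) : φ ∈ rad Y M := by
  by_contra hφ
  obtain ⟨A, B, i, q, hA, hB, hiso⟩ := exists_isIso_of_notMem_rad φ hφ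
  let r : Y ⟶ A := φ ≫ q ≫ inv (i ≫ φ ≫ q)
  have hir : i ≫ r = 𝟙 A := by
    have := IsIso.hom_inv_id (i ≫ φ ≫ q)
    simpa [r, - IsIso.inv_comp, - IsIso.hom_inv_id] using this
  have hfr : f ≫ r = 0 := by simp [r, reassoc_of% hfφ, - IsIso.inv_comp]
  rcases hf.2.2 Y f (𝟙 Y - r ≫ i) (by simp [reassoc_of% hfr]) with h | h
  · exact hf.1 h
  · have h1 : (𝟙 Y - r ≫ i) ≫ r = 0 := by simp [hir]
    have h2 : r = 0 := zero_of_epi_comp _ h1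
    exact hA.1 ((IsZero.iff_id_eq_zero A).2 (by rw [← hir, h2, comp_zero]))

variable [IsIdempotentComplete C]

/-- A non-isomorphism between indecomposable retracts of `W` gives an element of the Jacobson
radical of `End W`: every element of the left ideal it generates becomes invertible after adding
`1`, which is checked in the local ring `End A` through the identity relating the inverses of
`1 + x ≫ y` and `1 + y ≫ x`. -/
theorem comp_mem_jacobson {W A B : C} (hA : Indecomposable A) (hB : Indecomposable B)
    (g : A ⟶ B) (hg : ¬ IsIso g) (π : W ⟶ A) (ι : B ⟶ W) :
    End.of (π ≫ g ≫ ι) ∈ Ideal.jacobson (⊥ : Ideal (End W)) := by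
  rw [Ideal.mem_jacobson_iff]
  intro y
  let c : A ⟶ W := g ≫ ι ≫ y.asHom
  have hnil : IsNilpotent (End.of (c ≫ π)) := by
    refine (isNilpotent_or_isUnit_of_indecomposable hA _).resolve_right fun hu => hg ?_
    obtain ⟨r, hr⟩ := hu.exists_left_inv
    replace hr : (c ≫ π) ≫ r.asHom = 𝟙 A := hr
    exact isIso_of_comp_eq_id hA.1 hB g (ι ≫ y.asHom ≫ π ≫ r.asHom) (by simpa [c] using hr)
  obtain ⟨v, hv⟩ := hnil.isUnit_one_add.exists_left_inv
  replace hv : (𝟙 A + c ≫ π) ≫ v.asHom = 𝟙 A := hv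
  refine ⟨End.of (𝟙 W - π ≫ v.asHom ≫ c), (Submodule.mem_bot _).2 ?_⟩
  have hv' : π ≫ v.asHom ≫ c + π ≫ c ≫ π ≫ v.asHom ≫ c = π ≫ c := by
    have := congr_arg (fun t => π ≫ t ≫ c) hv
    simpa using this
  change (π ≫ g ≫ ι) ≫ y.asHom ≫ (𝟙 W - π ≫ v.asHom ≫ c) + (𝟙 W - π ≫ v.asHom ≫ c) - 𝟙 W = 0
  have hc : (π ≫ g ≫ ι) ≫ y.asHom ≫ (𝟙 W - π ≫ v.asHom ≫ c) =
      π ≫ c - π ≫ c ≫ π ≫ v.asHom ≫ c := by simp [c]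
  rw [hc]
  nth_rw 1 [← hv']
  abel

/-- If every indecomposable object is a retract of `W`, then the components in `End W` of the
morphisms of the `m`-th power of the radical lie in the `m`-th power of the Jacobson radical. -/
theorem comp_mem_jacobson_pow {W : C}
    (hW : ∀ A : C, Indecomposable A → ∃ (ι : A ⟶ W) (π : W ⟶ A), ι ≫ π = 𝟙 A) (m : ℕ) :
    ∀ {X Y : C} (φ : X ⟶ Y), φ ∈ radPow m X Y → ∀ (a : W ⟶ X) (b : Y ⟶ W),
      End.of (a ≫ φ ≫ b) ∈ Ideal.jacobson (⊥ : Ideal (End W)) ^ m := by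
  induction m with
  | zero => intro X Y φ _ a b; exact (Ideal.one_eq_top (R := End W)).ge trivial
  | succ m ih =>
    intro X Y φ hφ a b
    refine AddSubgroup.closure_induction (p := fun φ _ =>
      End.of (a ≫ φ ≫ b) ∈ Ideal.jacobson (⊥ : Ideal (End W)) ^ (m + 1)) ?_ ?_ ?_ ?_ hφ
    · rintro _ ⟨Z, g, h, hg, hh, rfl⟩
      refine AddSubgroup.closure_induction (p := fun h _ =>
        End.of (a ≫ (g ≫ h) ≫ b) ∈ Ideal.jacobson (⊥ : Ideal (End W)) ^ (m + 1)) ?_ ?_ ?_ ?_ hh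
      · rintro _ ⟨A, B, s, t, r, hA, hB, ht, rfl⟩
        obtain ⟨ι, π, hιπ⟩ := hW A hA
        obtain ⟨ι', π', hιπ'⟩ := hW B hB
        have h1 := ih g hg a (s ≫ ι)
        have h2 := comp_mem_jacobson hA hB t ht π ι'
        have h3 := Ideal.mul_mem_left _ (End.of (π' ≫ r ≫ b)) (Ideal.mul_mem_mul h2 h1)
        have h4 : End.of (a ≫ (g ≫ s ≫ t ≫ r) ≫ b) =
            End.of (π' ≫ r ≫ b) * (End.of (π ≫ t ≫ ι') * End.of (a ≫ g ≫ s ≫ ι)) := by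
          change _ = ((a ≫ g ≫ s ≫ ι) ≫ π ≫ t ≫ ι') ≫ π' ≫ r ≫ b
          simp [End.of, reassoc_of% hιπ, reassoc_of% hιπ']
        rw [h4, Ideal.IsTwoSided.pow_succ]
        exact h3
      · rw [comp_zero, zero_comp, comp_zero]
        exact zero_mem _
      · intro x y _ _ hx hy
        rw [Preadditive.comp_add, Preadditive.add_comp, Preadditive.comp_add]
        exact add_mem hx hy
      · intro x _ hx
        rw [Preadditive.comp_neg, Preadditive.neg_comp, Preadditive.comp_neg]
        exact neg_mem hx
    · rw [zero_comp, comp_zero]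
      exact zero_mem _
    · intro x y _ _ hx hy
      rw [Preadditive.add_comp, Preadditive.comp_add]
      exact add_mem hx hy
    · intro x _ hx
      rw [Preadditive.neg_comp, Preadditive.comp_neg]
      exact neg_mem hx

/-- In finite type, some power of the radical vanishes. -/
theorem exists_radPow_eq_zero (hC : IsOfFiniteType C) :
    ∃ N : ℕ, ∀ {X Y : C} (φ : X ⟶ Y), φ ∈ radPow N X Y → φ = 0 := by
  by_cases hne : Nonempty C
  swap
  · exact ⟨0, fun {X} => (hne ⟨X⟩).elim⟩
  obtain ⟨W, hW⟩ := exists_forall_retract_of_isOfFiniteType hC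
  obtain ⟨N, hN⟩ := IsArtinianRing.isNilpotent_jacobson_bot (R := End W)
  refine ⟨N, fun {X Y} φ hφ => ?_⟩
  have h0 : ∀ (a : W ⟶ X) (b : Y ⟶ W), a ≫ φ ≫ b = 0 := fun a b => by
    have := comp_mem_jacobson_pow hW N φ hφ a b
    rw [hN] at this
    exact (Submodule.mem_bot _).1 this
  obtain ⟨s, _, A, i, p, hA, hX⟩ := isSumOfIndecomposables X
  obtain ⟨t, _, B, j, q, hB, hY⟩ := isSumOfIndecomposables Y
  rw [← Category.comp_id φ, ← Category.id_comp φ, ← hX, ← hY, Preadditive.sum_comp,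
    Preadditive.sum_comp]
  refine Finset.sum_eq_zero fun a _ => ?_
  rw [Preadditive.comp_sum]
  refine Finset.sum_eq_zero fun b _ => ?_
  obtain ⟨ι, π, h⟩ := hW (A a) (hA a)
  obtain ⟨ι', π', h'⟩ := hW (B b) (hB b)
  have := h0 (π ≫ i a) (q b ≫ ι')
  calc ((p a ≫ i a) ≫ φ) ≫ q b ≫ j b
      = p a ≫ ι ≫ ((π ≫ i a) ≫ φ ≫ q b ≫ ι') ≫ π' ≫ j b := by
        simp [reassoc_of% h, reassoc_of% h']
    _ = 0 := by rw [this]; simp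

/-! ### Degrees of irreducible morphisms -/

/-- When the radical is nilpotent, a nonzero radical morphism has a well-defined positive depth. -/
theorem exists_depth (hC : IsOfFiniteType C) {X Y : C} (φ : X ⟶ Y) (h0 : φ ≠ 0)
    (hφ : φ ∈ rad X Y) : ∃ m, 1 ≤ m ∧ φ ∈ radPow m X Y ∧ φ ∉ radPow (m + 1) X Y := by
  obtain ⟨N, hN⟩ := exists_radPow_eq_zero hC
  by_contra! hcon
  have : ∀ m, 1 ≤ m → φ ∈ radPow m X Y := fun m hm => by
    induction m, hm using Nat.le_induction with
    | base => exact mem_radPow_one hφ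
    | succ m hm ih => exact hcon m hm ih
  rcases Nat.eq_zero_or_pos N with rfl | hpos
  · exact h0 (hN φ trivial)
  · exact h0 (hN φ (this N hpos))

theorem leftDegree_lt_top (hC : IsOfFiniteType C) {M X Y : C} {f : X ⟶ Y}
    (hf : IsIrreducibleHom f) (φ : M ⟶ X) (h0 : φ ≠ 0) (hφf : φ ≫ f = 0) : leftDegree f < ⊤ := by
  obtain ⟨m, h1, h2, h3⟩ := exists_depth hC φ h0 (mem_rad_of_comp_eq_zero hf φ hφf)
  exact (iInf₂_le m ⟨h1, M, φ, h2, h3, hφf ▸ zero_mem _⟩).trans_lt (ENat.natCast_lt_top m)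

theorem rightDegree_lt_top (hC : IsOfFiniteType C) {M X Y : C} {f : X ⟶ Y}
    (hf : IsIrreducibleHom f) (φ : Y ⟶ M) (h0 : φ ≠ 0) (hfφ : f ≫ φ = 0) : rightDegree f < ⊤ := by
  obtain ⟨m, h1, h2, h3⟩ := exists_depth hC φ h0 (mem_rad_of_eq_zero_comp hf φ hfφ)
  exact (iInf₂_le m ⟨h1, M, φ, h2, h3, hfφ ▸ zero_mem _⟩).trans_lt (ENat.natCast_lt_top m)

end Category

/-! ### Idempotents and endomorphism rings in `proj Λ` and `C_n(proj Λ)` -/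

theorem isIdempotentComplete_fullSubcategory {C : Type u} [Category.{v} C] [IsIdempotentComplete C]
    (P : ObjectProperty C) [P.IsStableUnderRetracts] : IsIdempotentComplete P.FullSubcategory where
  idempotents_split X p hp := by
    obtain ⟨Y, i, e, hie, hei⟩ := IsIdempotentComplete.idempotents_split X.obj p.hom
      (by simpa using congr_arg InducedCategory.Hom.hom hp)
    have hY : P Y := P.prop_of_retract ⟨i, e, hie⟩ X.property
    exact ⟨⟨Y, hY⟩, ObjectProperty.homMk i, ObjectProperty.homMk e,
      by ext; exact hie, by ext; exact hei⟩

theorem isArtinianRing_end_of_finite {C : Type u} [Category.{v} C] [Preadditive C] (k : Type w)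
    [CommRing k] [IsArtinianRing k] [Linear k C] (X : C) [h : Module.Finite k (X ⟶ X)] :
    IsArtinianRing (End X) :=
  have : Module.Finite k (End X) := h
  .of_finite k (End X)

section Modules

variable (Λ : Type u) [Ring Λ]

instance : (isProj Λ).IsStableUnderRetracts where
  of_retract {M N} h hN := by
    have := hN.1
    have := hN.2
    have hr : h.r.hom ∘ₗ h.i.hom = LinearMap.id := congr_arg ModuleCat.Hom.hom h.retract
    exact ⟨.of_surjective h.r.hom fun x => ⟨h.i.hom x, LinearMap.congr_fun hr x⟩,
      .of_split h.i.hom h.r.hom hr⟩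

instance (n : ℕ) : (isSupported Λ n).IsStableUnderRetracts where
  of_retract {K L} h hL i hi := by
    rw [IsZero.iff_id_eq_zero]
    have := congr_arg (fun g => HomologicalComplex.Hom.f g i) h.retract
    dsimp at this
    rw [← this, (hL i hi).eq_of_tgt (h.i.f i) 0, zero_comp]

instance : IsIdempotentComplete (ProjCat Λ) := isIdempotentComplete_fullSubcategory _

instance (n : ℕ) : IsIdempotentComplete (Cn Λ n) := isIdempotentComplete_fullSubcategory _

variable (k : Type w) [CommRing k] [Algebra k Λ]

/-- The `k`-linear structure on the category of right modules over a `k`-algebra. -/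
abbrev linearModuleCat : Linear k (ModuleCat.{u} Λᵐᵒᵖ) :=
  letI (M : ModuleCat.{u} Λᵐᵒᵖ) : Module k M := Module.restrictScalars k Λᵐᵒᵖ M
  haveI (M : ModuleCat.{u} Λᵐᵒᵖ) : IsScalarTower k Λᵐᵒᵖ M := IsScalarTower.restrictScalars k Λᵐᵒᵖ M
  { homModule _ _ := inferInstance }

variable [IsArtinianRing k] [Module.Finite k Λ]

theorem finite_hom (P Q : ProjCat Λ) :
    letI := linearModuleCat Λ k
    Module.Finite k (P ⟶ Q) := by
  let := linearModuleCat Λ k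
  let (M : ModuleCat.{u} Λᵐᵒᵖ) : Module k M := Module.restrictScalars k Λᵐᵒᵖ M
  have (M : ModuleCat.{u} Λᵐᵒᵖ) : IsScalarTower k Λᵐᵒᵖ M := IsScalarTower.restrictScalars k Λᵐᵒᵖ M
  have h1 (M : ProjCat Λ) : Module.Finite k M.obj :=
    have := M.property.1
    .trans Λᵐᵒᵖ _
  let F : (P ⟶ Q) →ₗ[k] (P.obj →ₗ[k] Q.obj) :=
    { toFun f := f.hom.hom.restrictScalars k
      map_add' _ _ := rfl
      map_smul' _ _ := rfl }
  refine Module.Finite.of_injective F fun f g h => ?_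
  ext x
  exact LinearMap.congr_fun h x

include k in
theorem isArtinianRing_end_projCat (P : ProjCat Λ) : IsArtinianRing (End P) := by
  let := linearModuleCat Λ k
  have := finite_hom Λ k P P
  exact isArtinianRing_end_of_finite k P

include k in
theorem isArtinianRing_end_cn (n : ℕ) (X : Cn Λ n) : IsArtinianRing (End X) := by
  let := linearModuleCat Λ k
  have (i : ℤ) : Module.Finite k (X.obj.X i ⟶ X.obj.X i) := finite_hom Λ k _ _
  let F : (X ⟶ X) →ₗ[k] (∀ i : Set.Icc (1 : ℤ) n, X.obj.X i ⟶ X.obj.X i) :=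
    { toFun f i := f.hom.f i
      map_add' _ _ := rfl
      map_smul' _ _ := rfl }
  have : Module.Finite k (X ⟶ X) := by
    refine Module.Finite.of_injective F fun f g h => ?_
    apply InducedCategory.hom_ext
    ext i : 1
    by_cases hi : i ∈ Set.Icc (1 : ℤ) n
    · exact congr_fun h ⟨i, hi⟩
    · exact (X.property i hi).eq_of_src _ _
  exact isArtinianRing_end_of_finite k X

end Modules

/-! ### Projective modules over a selfinjective artin algebra -/

section Selfinjective

variable {Λ : Type u} [Ring Λ]

/-- The morphism of `proj Λ` given by a linear map. -/
abbrev projHom {P Q : ProjCat Λ} (l : P.obj →ₗ[Λᵐᵒᵖ] Q.obj) : P ⟶ Q :=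
  ObjectProperty.homMk (ModuleCat.ofHom l)

variable (Λ) in
/-- The regular right module as an object of `proj Λ`. -/
abbrev regular : ProjCat Λ :=
  ⟨ModuleCat.of Λᵐᵒᵖ Λᵐᵒᵖ, inferInstanceAs (Module.Finite Λᵐᵒᵖ Λᵐᵒᵖ),
    inferInstanceAs (Module.Projective Λᵐᵒᵖ Λᵐᵒᵖ)⟩

theorem injective_op (h : Module.Injective Λᵐᵒᵖ Λ) : Module.Injective Λᵐᵒᵖ Λᵐᵒᵖ := by
  let e : Λ ≃ₗ[Λᵐᵒᵖ] Λᵐᵒᵖ :=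
    { MulOpposite.opAddEquiv with map_smul' _ _ := rfl }
  exact ((Module.Baer.of_injective h).of_equiv e).injective

theorem injective_of_isProj (h : Module.Injective Λᵐᵒᵖ Λ) (P : ProjCat Λ) :
    Module.Injective Λᵐᵒᵖ P.obj := by
  have := injective_op h
  have := P.property.1
  have := P.property.2
  obtain ⟨n, r, s, _, _, hrs⟩ := Module.Finite.exists_comp_eq_id_of_projective Λᵐᵒᵖ P.obj
  refine ⟨fun A B _ _ _ _ i hi g => ?_⟩
  obtain ⟨t, ht⟩ := Module.Injective.out i hi (s ∘ₗ g)
  exact ⟨r ∘ₗ t, fun x => by simpa [ht] using LinearMap.congr_fun hrs (g x)⟩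

theorem isSplitMono_of_mono (inj : Module.Injective Λᵐᵒᵖ Λ) {P Q : ProjCat Λ} (f : P ⟶ Q)
    [Mono f] : IsSplitMono f := by
  have hinj : Function.Injective f.hom.hom := by
    rw [← LinearMap.ker_eq_bot, LinearMap.ker_eq_bot']
    intro x hx
    let q : regular Λ ⟶ P := projHom (LinearMap.toSpanSingleton Λᵐᵒᵖ P.obj x)
    have hq : q ≫ f = 0 := by
      ext
      change f.hom.hom ((1 : Λᵐᵒᵖ) • x) = 0
      rw [one_smul, hx]
    have h0 : q = 0 := zero_of_comp_mono f hq
    have h1 : (1 : Λᵐᵒᵖ) • x = 0 :=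
      LinearMap.congr_fun (congr_arg (fun t => t.hom.hom) h0) 1
    rwa [one_smul] at h1
  obtain ⟨r, hr⟩ := (injective_of_isProj inj P).out f.hom.hom hinj LinearMap.id
  exact ⟨⟨⟨projHom r, by ext x; exact hr x⟩⟩⟩

variable [∀ P : ProjCat Λ, IsArtinianRing (End P)]

/-- Fitting's lemma for an indecomposable object of `proj Λ`, in terms of linear maps. -/
theorem exists_inverse_of_pow_ne_zero {P : ProjCat Λ}
    (hP : Indecomposable P) (e : P.obj →ₗ[Λᵐᵒᵖ] P.obj)
    (h : ∀ n : ℕ, e ^ n ≠ 0) : ∃ r : P.obj →ₗ[Λᵐᵒᵖ] P.obj, r ∘ₗ e = LinearMap.id ∧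
      e ∘ₗ r = LinearMap.id := by
  have hpow : ∀ n : ℕ, End.asHom (End.of (projHom e) ^ n) = projHom (e ^ n) := by
    intro n
    induction n with
    | zero => rfl
    | succ n ih =>
      rw [pow_succ, pow_succ]
      change projHom e ≫ End.asHom (End.of (projHom e) ^ n) = _
      rw [ih]
      rfl
  rcases isNilpotent_or_isUnit_of_indecomposable hP (End.of (projHom e)) with ⟨n, hn⟩ | hu
  · refine absurd ?_ (h n)
    have h1 := (hpow n).symm.trans hn
    exact congr_arg (fun t : P ⟶ P => t.hom.hom) h1
  · obtain ⟨⟨x, r, h1, h2⟩, rfl⟩ := hu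
    refine ⟨r.asHom.hom.hom, ?_, ?_⟩
    · exact congr_arg (fun t : P ⟶ P => t.hom.hom) h2
    · exact congr_arg (fun t : P ⟶ P => t.hom.hom) h1

/-- An indecomposable projective module has, up to isomorphism, only one simple quotient. If the
kernels of `a` and `b` were different, lifting `a` through its restriction to `ker b` would give an
endomorphism of `P` that is neither nilpotent nor invertible. -/
theorem nonempty_equiv_of_quotients {P : ProjCat Λ} (hP : Indecomposable P) {S T : Type u}
    [AddCommGroup S] [Module Λᵐᵒᵖ S] [AddCommGroup T] [Module Λᵐᵒᵖ T]
    [IsSimpleModule Λᵐᵒᵖ S] [IsSimpleModule Λᵐᵒᵖ T] (a : P.obj →ₗ[Λᵐᵒᵖ] S) (b : P.obj →ₗ[Λᵐᵒᵖ] T)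
    (ha : a ≠ 0) (hb : b ≠ 0) : Nonempty (T ≃ₗ[Λᵐᵒᵖ] S) := by
  by_cases hle : LinearMap.ker b ≤ LinearMap.ker a
  · let q := (LinearMap.ker b).liftQ a hle
    let e := b.quotKerEquivOfSurjective (LinearMap.surjective_of_ne_zero hb)
    have hne : q ∘ₗ e.symm.toLinearMap ≠ 0 := by
      intro h0
      refine ha (LinearMap.ext fun x => ?_)
      have h1 : q (Submodule.Quotient.mk x) = a x := rfl
      rw [← h1, ← e.symm_apply_apply (Submodule.Quotient.mk x)]
      exact LinearMap.congr_fun h0 _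
    exact ⟨.ofBijective _ (LinearMap.bijective_of_ne_zero hne)⟩
  · exfalso
    have := P.property.2
    obtain ⟨x, hxb, hxa⟩ := SetLike.not_le_iff_exists.1 hle
    have hne : a ∘ₗ (LinearMap.ker b).subtype ≠ 0 := fun h0 =>
      hxa (LinearMap.congr_fun h0 ⟨x, hxb⟩)
    obtain ⟨h, hh⟩ := Module.projective_lifting_property _ a (LinearMap.surjective_of_ne_zero hne)
    let e := (LinearMap.ker b).subtype ∘ₗ h
    have hae : a ∘ₗ e = a := hh
    have hbe : b ∘ₗ e = 0 := LinearMap.ext fun y => (h y).2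
    have hpow : ∀ n : ℕ, a ∘ₗ (e ^ n) = a := fun n => by
      induction n with
      | zero => rfl
      | succ n ih =>
        rw [pow_succ, Module.End.mul_eq_comp, ← LinearMap.comp_assoc, ih, hae]
    obtain ⟨r, -, hr⟩ := exists_inverse_of_pow_ne_zero hP e fun n h0 => ha (by
      rw [← hpow n, h0, LinearMap.comp_zero])
    refine hb ?_
    rw [← LinearMap.comp_id b, ← hr, ← LinearMap.comp_assoc, hbe, LinearMap.zero_comp]

/-- Indecomposable projective modules that are injective and share a simple submodule are
isomorphic. -/
theorem nonempty_iso_of_submodules (inj : Module.Injective Λᵐᵒᵖ Λ) {P Q : ProjCat Λ}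
    (hP : Indecomposable P) (hQ : Indecomposable Q) {T : Type u} [AddCommGroup T]
    [Module Λᵐᵒᵖ T] [Nontrivial T] (a : T →ₗ[Λᵐᵒᵖ] P.obj) (b : T →ₗ[Λᵐᵒᵖ] Q.obj)
    (ha : Function.Injective a) (hb : Function.Injective b) : Nonempty (P ≅ Q) := by
  obtain ⟨g, hg⟩ := (injective_of_isProj inj Q).out a ha b
  obtain ⟨h, hh⟩ := (injective_of_isProj inj P).out b hb a
  obtain ⟨t, ht⟩ := exists_ne (0 : T)
  have hpow : ∀ n : ℕ, ((h ∘ₗ g) ^ n) (a t) = a t := fun n => by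
    induction n with
    | zero => rfl
    | succ n ih => rw [pow_succ, Module.End.mul_apply, LinearMap.comp_apply, hg, hh, ih]
  obtain ⟨r, hr, -⟩ := exists_inverse_of_pow_ne_zero hP (h ∘ₗ g) fun n h0 => ht (ha (by
    rw [← hpow n, h0, LinearMap.zero_apply, map_zero]))
  have := isIso_of_comp_eq_id hP.1 hQ (projHom g) (projHom (r ∘ₗ h)) (by
    ext x
    exact LinearMap.congr_fun hr x)
  exact ⟨asIso (projHom g)⟩

/-- Every simple module over a selfinjective artin algebra embeds in a projective module: sending
an indecomposable projective module to the projective cover of its socle is an injective map from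
the finite set of isomorphism classes of indecomposable projective modules to itself, hence it is
surjective. -/
theorem exists_embedding_of_isSimpleModule [IsArtinianRing Λᵐᵒᵖ]
    (inj : Module.Injective Λᵐᵒᵖ Λ) (S : Type u)
    [AddCommGroup S] [Module Λᵐᵒᵖ S] [IsSimpleModule Λᵐᵒᵖ S] :
    ∃ (P : ProjCat Λ) (a : S →ₗ[Λᵐᵒᵖ] P.obj), Function.Injective a := by
  obtain ⟨ι, _, A, i, p, hA, hΛ⟩ := isSumOfIndecomposables (regular Λ)
  have top : ∀ (T : Type u) [AddCommGroup T] [Module Λᵐᵒᵖ T] [IsSimpleModule Λᵐᵒᵖ T],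
      ∃ (j : ι) (a : (A j).obj →ₗ[Λᵐᵒᵖ] T), a ≠ 0 := by
    intro T _ _ _
    have := IsSimpleModule.nontrivial Λᵐᵒᵖ T
    obtain ⟨t, ht⟩ := exists_ne (0 : T)
    let q : (regular Λ).obj ⟶ ModuleCat.of Λᵐᵒᵖ T :=
      ModuleCat.ofHom (LinearMap.toSpanSingleton Λᵐᵒᵖ T t)
    by_contra! hcon
    have h0 : ∀ j, (i j).hom ≫ q = 0 := fun j => ModuleCat.hom_ext (hcon j _)
    have h1 : (∑ j, p j ≫ i j).hom ≫ q = 0 := by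
      have : (∑ j, p j ≫ i j).hom = ∑ j, (p j ≫ i j).hom :=
        map_sum ((isProj Λ).ι.mapAddHom) _ _
      rw [this, Preadditive.sum_comp]
      exact Finset.sum_eq_zero fun j _ => by simp [h0]
    rw [hΛ] at h1
    have h2 : (1 : Λᵐᵒᵖ) • t = 0 := LinearMap.congr_fun (congr_arg ModuleCat.Hom.hom h1) 1
    exact ht (by rwa [one_smul] at h2)
  have soc : ∀ j, ∃ T : Submodule Λᵐᵒᵖ (A j).obj, IsSimpleModule Λᵐᵒᵖ T := by
    intro j
    have := (A j).property.1
    have : Nontrivial (A j).obj := by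
      by_contra hn
      rw [not_nontrivial_iff_subsingleton] at hn
      refine (hA j).1 ((IsZero.iff_id_eq_zero _).2 ?_)
      ext x
      exact Subsingleton.elim _ _
    obtain ⟨T, hT⟩ := IsAtomic.exists_atom (Submodule Λᵐᵒᵖ (A j).obj)
    exact ⟨T, isSimpleModule_iff_isAtom.2 hT⟩
  choose T hT using soc
  choose ν a ha using fun j => top (T j)
  let s : Setoid ι := (isIsomorphicSetoid (ProjCat Λ)).comap A
  let G : Quotient s → Quotient s := fun q => ⟦ν q.out⟧
  have hG : Function.Injective G := by
    intro q q' h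
    obtain ⟨e⟩ : Nonempty (A (ν q.out) ≅ A (ν q'.out)) := Quotient.exact h
    have he : (a q'.out) ∘ₗ e.hom.hom.hom ≠ 0 := by
      intro h0
      refine ha q'.out (LinearMap.ext fun x => ?_)
      have h1 : e.hom.hom.hom (e.inv.hom.hom x) = x :=
        LinearMap.congr_fun (congr_arg (fun t => t.hom.hom) e.inv_hom_id) x
      rw [← h1]
      exact LinearMap.congr_fun h0 _
    obtain ⟨e'⟩ := nonempty_equiv_of_quotients (hA _) _ (a q.out) he (ha q.out)
    have := IsSimpleModule.nontrivial Λᵐᵒᵖ (T q.out)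
    rw [← q.out_eq, ← q'.out_eq]
    exact Quotient.sound (nonempty_iso_of_submodules inj (hA _) (hA _) (T q.out).subtype
      ((T q'.out).subtype ∘ₗ e'.toLinearMap) Subtype.val_injective
      (Subtype.val_injective.comp e'.injective))
  obtain ⟨j, b, hb⟩ := top S
  obtain ⟨q, hq⟩ := Finite.surjective_of_injective hG ⟦j⟧
  obtain ⟨e⟩ : Nonempty (A (ν q.out) ≅ A j) := Quotient.exact hq
  have he : b ∘ₗ e.hom.hom.hom ≠ 0 := by
    intro h0
    refine hb (LinearMap.ext fun x => ?_)
    have h1 : e.hom.hom.hom (e.inv.hom.hom x) = x :=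
      LinearMap.congr_fun (congr_arg (fun t => t.hom.hom) e.inv_hom_id) x
    rw [← h1]
    exact LinearMap.congr_fun h0 _
  obtain ⟨e'⟩ := nonempty_equiv_of_quotients (hA _) (a q.out) _ (ha q.out) he
  exact ⟨A q.out, (T q.out).subtype ∘ₗ e'.toLinearMap, Subtype.val_injective.comp e'.injective⟩

theorem isSplitEpi_of_epi [IsArtinianRing Λᵐᵒᵖ] (inj : Module.Injective Λᵐᵒᵖ Λ) {P Q : ProjCat Λ}
    (f : P ⟶ Q) [Epi f] : IsSplitEpi f := by
  have := Q.property.1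
  have := Q.property.2
  have hsurj : Function.Surjective f.hom.hom := by
    rw [← LinearMap.range_eq_top]
    -- A proper image lies in a maximal submodule, whose quotient embeds in a projective module.
    by_contra hne
    obtain ⟨K, hK, hle⟩ := (eq_top_or_exists_le_coatom _).resolve_left hne
    have : IsSimpleModule Λᵐᵒᵖ (Q.obj ⧸ K) := isSimpleModule_iff_isCoatom.2 hK
    obtain ⟨M, a, ha⟩ := exists_embedding_of_isSimpleModule inj (Q.obj ⧸ K)
    have h0 : projHom (a ∘ₗ K.mkQ) = 0 := by
      refine zero_of_epi_comp f ?_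
      ext x
      change a (K.mkQ (f.hom.hom x)) = 0
      rw [Submodule.mkQ_apply, (Submodule.Quotient.mk_eq_zero K).2 (hle ⟨x, rfl⟩), map_zero]
    refine hK.1 (eq_top_iff.2 fun x _ => (Submodule.Quotient.mk_eq_zero K).1 (ha ?_))
    rw [map_zero]
    exact LinearMap.congr_fun (congr_arg (fun t : Q ⟶ M => t.hom.hom) h0) x
  obtain ⟨r, hr⟩ := Module.projective_lifting_property f.hom.hom LinearMap.id hsurj
  exact ⟨⟨⟨projHom r, by ext x; exact LinearMap.congr_fun hr x⟩⟩⟩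

end Selfinjective

/-! ### Extending annihilators of components to complexes -/

section Double

variable {C : Type u} [Category.{v} C] [HasZeroMorphisms C] [HasZeroObject C] {X₀ X₁ : C}
  {g : X₀ ⟶ X₁} {ι : Type*} {c : ComplexShape ι} {i₀ i₁ : ι} (hi₀₁ : c.Rel i₀ i₁) (h : i₀ ≠ i₁)
  {K : HomologicalComplex C c} (φ₀ : K.X i₀ ⟶ X₀) (φ₁ : K.X i₁ ⟶ X₁)
  (comm : φ₀ ≫ g = K.d i₀ i₁ ≫ φ₁) (hφ : ∀ j, c.Rel j i₀ → K.d j i₀ ≫ φ₀ = 0)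

open scoped Classical in
/-- Constructor for morphisms to a complex concentrated in two consecutive degrees. -/
noncomputable def mkHomToDouble : K ⟶ HomologicalComplex.double g hi₀₁ where
  f j :=
    if hj₀ : j = i₀ then
      eqToHom (by rw [hj₀]) ≫ φ₀ ≫ (HomologicalComplex.doubleXIso₀ g hi₀₁).inv ≫
        eqToHom (by rw [hj₀])
    else if hj₁ : j = i₁ then
      eqToHom (by rw [hj₁]) ≫ φ₁ ≫ (HomologicalComplex.doubleXIso₁ g hi₀₁ h).inv ≫
        eqToHom (by rw [hj₁])
    else 0
  comm' j₀ j₁ hj := by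
    by_cases h₁ : j₁ = i₁
    · subst h₁
      obtain rfl := c.prev_eq hj hi₀₁
      simp [dif_neg h.symm, HomologicalComplex.double_d g hi₀₁ h, reassoc_of% comm]
    · by_cases h₀ : j₁ = i₀
      · subst h₀
        rw [HomologicalComplex.double_d_eq_zero₁ _ _ _ _ h, comp_zero]
        simp [reassoc_of% (hφ j₀ hj)]
      · apply (HomologicalComplex.isZero_double_X g hi₀₁ j₁ h₀ h₁).eq_of_tgt

@[simp]
theorem mkHomToDouble_f₀ : (mkHomToDouble hi₀₁ h φ₀ φ₁ comm hφ).f i₀ =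
    φ₀ ≫ (HomologicalComplex.doubleXIso₀ g hi₀₁).inv := by
  simp [mkHomToDouble]

@[simp]
theorem mkHomToDouble_f₁ : (mkHomToDouble hi₀₁ h φ₀ φ₁ comm hφ).f i₁ =
    φ₁ ≫ (HomologicalComplex.doubleXIso₁ g hi₀₁ h).inv := by
  simp [mkHomToDouble, h.symm]

end Double

section Complexes

open scoped ZeroObject

variable {Λ : Type u} [Ring Λ] {n : ℕ} {X Y : Cn Λ n}

instance : HasZeroObject (ProjCat Λ) :=
  have : Nonempty (ProjCat Λ) := ⟨regular Λ⟩
  hasZeroObject_of_isIdempotentComplete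

theorem double_mem_isSupported {P Q : ProjCat Λ} (g : P ⟶ Q) {i j : ℤ}
    (hij : (ComplexShape.up ℤ).Rel i j) (hP : i ∉ Set.Icc 1 (n : ℤ) → IsZero P)
    (hQ : j ∉ Set.Icc 1 (n : ℤ) → IsZero Q) :
    isSupported Λ n (HomologicalComplex.double g hij) := by
  have hne : i ≠ j := by
    change i + 1 = j at hij
    omega
  intro l hl
  by_cases h0 : l = i
  · subst h0
    exact (hP hl).of_iso (HomologicalComplex.doubleXIso₀ g hij)
  by_cases h1 : l = j
  · subst h1
    exact (hQ hl).of_iso (HomologicalComplex.doubleXIso₁ g hij hne)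
  exact HomologicalComplex.isZero_double_X g hij l h0 h1

/-- If a component of `f` is not a monomorphism of `proj Λ`, then `f` is not a monomorphism of
`C_n(proj Λ)`: a map `p : P ⟶ X^i` extends to the contractible complex `P = P` in the degrees `i`
and `i + 1`, or to the complex `P` in degree `n` if `i = n`. -/
theorem exists_comp_eq_zero_of_not_mono (f : X ⟶ Y) {i : ℤ} (hi : i ∈ Set.Icc (1 : ℤ) n)
    (hf : ¬ Mono (f.hom.f i)) : ∃ (M : Cn Λ n) (φ : M ⟶ X), φ ≠ 0 ∧ φ ≫ f = 0 := by
  obtain ⟨P, p, hp, hp0⟩ : ∃ (P : ProjCat Λ) (p : P ⟶ X.obj.X i), p ≫ f.hom.f i = 0 ∧ p ≠ 0 := by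
    by_contra! hcon
    exact hf (Preadditive.mono_of_cancel_zero _ fun {P} p hp => hcon P p hp)
  obtain ⟨Q, g, q, hcomm, hq, hQ⟩ : ∃ (Q : ProjCat Λ) (g : P ⟶ Q) (q : Q ⟶ X.obj.X (i + 1)),
      p ≫ X.obj.d i (i + 1) = g ≫ q ∧ (q ≫ f.hom.f (i + 1) = 0 ∧
        ∀ l, q ≫ X.obj.d (i + 1) l = 0) ∧ (i + 1 ∉ Set.Icc 1 (n : ℤ) → IsZero Q) := by
    by_cases h : i + 1 ∈ Set.Icc 1 (n : ℤ)
    · exact ⟨P, 𝟙 P, p ≫ X.obj.d i (i + 1), by simp,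
        ⟨by rw [Category.assoc, ← HomologicalComplex.Hom.comm, reassoc_of% hp, zero_comp],
          by simp⟩, fun h' => absurd h h'⟩
    · exact ⟨0, 0, 0, by simp [(X.property _ h).eq_of_tgt (X.obj.d i (i + 1)) 0], by simp,
        fun _ => isZero_zero _⟩
  have hrel : (ComplexShape.up ℤ).Rel i (i + 1) := rfl
  have hne : i ≠ i + 1 := by omega
  let φ := HomologicalComplex.mkHomFromDouble hrel hne p q hcomm fun l _ => hq.2 l
  refine ⟨⟨HomologicalComplex.double g hrel,
    double_mem_isSupported g hrel (fun h => absurd hi h) hQ⟩, ObjectProperty.homMk φ, ?_, ?_⟩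
  · intro h0
    have h1 : φ.f i = 0 := congr_arg (fun t => t.hom.f i) h0
    rw [HomologicalComplex.mkHomFromDouble_f₀] at h1
    refine hp0 ?_
    rw [← cancel_epi (HomologicalComplex.doubleXIso₀ g hrel).hom, h1, comp_zero]
  · apply InducedCategory.hom_ext
    apply HomologicalComplex.from_double_hom_ext
    · change φ.f i ≫ f.hom.f i = 0
      rw [HomologicalComplex.mkHomFromDouble_f₀, Category.assoc, hp, comp_zero]
    · change φ.f (i + 1) ≫ f.hom.f (i + 1) = 0
      rw [HomologicalComplex.mkHomFromDouble_f₁, Category.assoc, hq.1, comp_zero]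

theorem exists_eq_zero_comp_of_not_epi (f : X ⟶ Y) {i : ℤ} (hi : i ∈ Set.Icc (1 : ℤ) n)
    (hf : ¬ Epi (f.hom.f i)) : ∃ (M : Cn Λ n) (φ : Y ⟶ M), φ ≠ 0 ∧ f ≫ φ = 0 := by
  obtain ⟨P, p, hp, hp0⟩ : ∃ (P : ProjCat Λ) (p : Y.obj.X i ⟶ P), f.hom.f i ≫ p = 0 ∧ p ≠ 0 := by
    by_contra! hcon
    exact hf (Preadditive.epi_of_cancel_zero _ fun {P} p hp => hcon P p hp)
  obtain ⟨Q, g, q, hcomm, hq, hQ⟩ : ∃ (Q : ProjCat Λ) (g : Q ⟶ P) (q : Y.obj.X (i - 1) ⟶ Q),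
      q ≫ g = Y.obj.d (i - 1) i ≫ p ∧ (f.hom.f (i - 1) ≫ q = 0 ∧
        ∀ l, Y.obj.d l (i - 1) ≫ q = 0) ∧ (i - 1 ∉ Set.Icc 1 (n : ℤ) → IsZero Q) := by
    by_cases h : i - 1 ∈ Set.Icc 1 (n : ℤ)
    · exact ⟨P, 𝟙 P, Y.obj.d (i - 1) i ≫ p, by simp,
        ⟨by rw [HomologicalComplex.Hom.comm_assoc, hp, comp_zero], by simp⟩,
        fun h' => absurd h h'⟩
    · exact ⟨0, 0, 0, by simp [(Y.property _ h).eq_of_src (Y.obj.d (i - 1) i) 0], by simp,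
        fun _ => isZero_zero _⟩
  have hrel : (ComplexShape.up ℤ).Rel (i - 1) i := by
    change i - 1 + 1 = i
    omega
  have hne : i - 1 ≠ i := by omega
  let φ := mkHomToDouble hrel hne q p hcomm fun l _ => hq.2 l
  refine ⟨⟨HomologicalComplex.double g hrel,
    double_mem_isSupported g hrel hQ (fun h => absurd hi h)⟩, ObjectProperty.homMk φ, ?_, ?_⟩
  · intro h0
    have h1 : φ.f i = 0 := congr_arg (fun t => t.hom.f i) h0
    rw [mkHomToDouble_f₁] at h1
    refine hp0 ?_
    rw [← cancel_mono (HomologicalComplex.doubleXIso₁ g hrel hne).inv, h1, zero_comp]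
  · apply InducedCategory.hom_ext
    apply HomologicalComplex.to_double_hom_ext
    · change f.hom.f (i - 1) ≫ φ.f (i - 1) = 0
      rw [mkHomToDouble_f₀, reassoc_of% hq.1, zero_comp]
    · change f.hom.f i ≫ φ.f i = 0
      rw [mkHomToDouble_f₁, reassoc_of% hp, zero_comp]

theorem isIso_of_forall_isIso (f : X ⟶ Y)
    (h : ∀ i ∈ Set.Icc (1 : ℤ) n, IsIso (f.hom.f i)) : IsIso f := by
  have (i : ℤ) : IsIso (f.hom.f i) := by
    by_cases hi : i ∈ Set.Icc (1 : ℤ) n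
    · exact h i hi
    · exact ⟨0, (X.property i hi).eq_of_src _ _, (Y.property i hi).eq_of_src _ _⟩
  have : IsIso f.hom := HomologicalComplex.Hom.isIso_of_components f.hom
  exact ⟨ObjectProperty.homMk (inv f.hom), by ext : 1; simp, by ext : 1; simp⟩

/-- An irreducible morphism of type (ret) has a component that is not a monomorphism, since
otherwise all components would be isomorphisms. -/
theorem IsTypeRet.exists_not_mono {f : X ⟶ Y} (h : IsTypeRet f) (hf : IsIrreducibleHom f) :
    ∃ i ∈ Set.Icc (1 : ℤ) n, ¬ Mono (f.hom.f i) := by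
  by_contra! hcon
  have := isIso_of_forall_isIso f fun i hi =>
    have := h i hi
    have := hcon i hi
    isIso_of_mono_of_isSplitEpi _
  exact hf.1 inferInstance

theorem IsTypeSec.exists_not_epi {f : X ⟶ Y} (h : IsTypeSec f) (hf : IsIrreducibleHom f) :
    ∃ i ∈ Set.Icc (1 : ℤ) n, ¬ Epi (f.hom.f i) := by
  by_contra! hcon
  have := isIso_of_forall_isIso f fun i hi =>
    have := h i hi
    have := hcon i hi
    isIso_of_epi_of_isSplitMono _
  exact hf.1 inferInstance

end Complexes

end CnProj

theorem mainTheorem11 {k : Type w} [CommRing k] [IsArtinianRing k]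
    {Λ : Type u} [Ring Λ] [Algebra k Λ] [Module.Finite k Λ]
    (selfinjective : Module.Injective Λᵐᵒᵖ Λ)
    (n : ℕ) (finiteType : CnProj.IsOfFiniteType (CnProj.Cn Λ n))
    {X Y : CnProj.Cn Λ n} (f : X ⟶ Y) (hf : CnProj.IsIrreducibleHom f)
    (hXY : Indecomposable X ∨ Indecomposable Y) :
    (CnProj.IsTypeSec f → CnProj.rightDegree f < ⊤) ∧
    (CnProj.IsTypeRet f → CnProj.leftDegree f < ⊤) ∧
    (CnProj.IsTypeRetIrredSec f → CnProj.leftDegree f < ⊤ ∧ CnProj.rightDegree f < ⊤) := by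
  have : IsArtinianRing Λᵐᵒᵖ := .of_finite k Λᵐᵒᵖ
  have (P : CnProj.ProjCat Λ) : IsArtinianRing (End P) := CnProj.isArtinianRing_end_projCat Λ k P
  have (Z : CnProj.Cn Λ n) : IsArtinianRing (End Z) := CnProj.isArtinianRing_end_cn Λ k n Z
  have left {i : ℤ} (hi : i ∈ Set.Icc (1 : ℤ) n) (h : ¬ Mono (f.hom.f i)) :
      CnProj.leftDegree f < ⊤ := by
    obtain ⟨M, φ, h0, hφ⟩ := CnProj.exists_comp_eq_zero_of_not_mono f hi h
    exact CnProj.leftDegree_lt_top finiteType hf φ h0 hφ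
  have right {i : ℤ} (hi : i ∈ Set.Icc (1 : ℤ) n) (h : ¬ Epi (f.hom.f i)) :
      CnProj.rightDegree f < ⊤ := by
    obtain ⟨M, φ, h0, hφ⟩ := CnProj.exists_eq_zero_comp_of_not_epi f hi h
    exact CnProj.rightDegree_lt_top finiteType hf φ h0 hφ
  refine ⟨fun h => ?_, fun h => ?_,
    fun ⟨i, hi, hirr, _⟩ => ⟨left hi fun _ => ?_, right hi fun _ => ?_⟩⟩
  · obtain ⟨i, hi, hfi⟩ := h.exists_not_epi hf
    exact right hi hfi
  · obtain ⟨i, hi, hfi⟩ := h.exists_not_mono hf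
    exact left hi hfi
  · exact hirr.1 (CnProj.isSplitMono_of_mono selfinjective _)
  · exact hirr.2.1 (CnProj.isSplitEpi_of_epi selfinjective _)
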